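/- A category is *regular* if it has finite limits, every kernel pair has a coequalizer, and regular epimorphisms are stable under pullback; it is *Mal'tsev* if it is finitely complete and every internal reflexive relation in it is an equivalence relation; it is *pointed* if it has a zero object. A pair of arrows $f\colon A\to Z$, $g\colon B\to Z$ is *jointly extremally epimorphic* if every monomorphism into $Z$ through which both $f$ and $g$ factor is an isomorphism. A functor is *coherent* if it preserves finite limits and jointly extremally epimorphic pairs of arrows. Let $\mathbb{C}$ be a pointed regular category with binary coproducts and let $n\ge 2$. For objects $K_1,\dots,K_n$ and $1\le k\le n$, let $\widehat\pi_k\colon \coprod_{i=1}^n K_i\to\coprod_{i\neq k}K_i$ be the arrow which is zero on $K_k$ and the coproduct inclusion on $K_i$ for $i\ne k$. The *co-smash product* $\iota\colon K_1\diamond\cdots\diamond K_n\to \coprod_{i=1}^n K_i$ is the kernel of $(\widehat\pi_1,\dots,\widehat\pi_n)\colon \coprod_{i=1}^nK_i\to\prod_{k=1}^n\coprod_{i\ne k}K_i$. The *Higgins commutator* of a family of arrows $(k_i\colon K_i\to X)_{1\le i\le n}$ is the subobject of $X$ given by the image of $(k_1\,\cdots\,k_n)\circ\iota\colon K_1\diamond\cdots\diamond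 K_n\to X$. The Higgins commutator $[K_1,\dots,K_n]\le X$ of subobjects $K_i\le X$ is that of monomorphisms $k_i\colon K_i\to X$ representing them. **Proposition.** Let $F\colon\mathbb{C}\to\mathbb{D}$ be a coherent functor between pointed regular Mal'tsev categories with binary coproducts. Then $F$ preserves Higgins commutators of arbitrary length $n\ge 2$: for all subobjects $K_1,\dots,K_n$ of an object $X$ of $\mathbb{C}$, $$F[K_1,\dots,K_n]=[FK_1,\dots,FK_n]$$ as subobjects of $FX$, where $F$ sends the subobject represented by a monomorphism $m$ to the one represented by the monomorphism $F(m)$. Likewise, for every family of arrows $(k_i\colon K_i\to X)_{1\le i\le n}$ in $\mathbb{C}$, $F$ sends its Higgins commutator to the Higgins commutator of the family $(F(k_i)\colon FK_i\to FX)_{1\le i\le n}$. -/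

import Mathlib

open CategoryTheory CategoryTheory.Limits

universe v₁ u₁ v₂ u₂

namespace HigginsCommutator

/-- A pointed category with binary coproducts has all finite coproducts (the zero object is
initial). -/
instance hasFiniteCoproducts_of_pointed (C : Type u₁) [Category.{v₁} C] [HasZeroObject C]
    [HasBinaryCoproducts C] : HasFiniteCoproducts C :=
  hasFiniteCoproducts_of_has_binary_and_initial

/-- A Mal'tsev category: a finitely complete category in which every internal reflexive relation
is an (internal) equivalence relation. -/
class MaltsevCategory (C : Type u₁) [Category.{v₁} C] : Prop extends HasFiniteLimits C where
  isEquivalenceRelation_of_reflexive : ∀ {R X : C} (p₁ p₂ : R ⟶ X),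
    ReflexiveRelation p₁ p₂ → IsEquivalenceRelation p₁ p₂

/-- A pair of arrows `f`, `g` with common codomain `Z` is jointly extremally epimorphic when every
monomorphism into `Z` through which both `f` and `g` factor is an isomorphism. -/
def JointlyExtremallyEpic {C : Type u₁} [Category.{v₁} C] {A B Z : C} (f : A ⟶ Z) (g : B ⟶ Z) :
    Prop :=
  ∀ ⦃M : C⦄ (m : M ⟶ Z) [Mono m],
    (∃ a : A ⟶ M, a ≫ m = f) → (∃ b : B ⟶ M, b ≫ m = g) → IsIso m

/-- A functor is coherent when it preserves finite limits and jointly extremally epimorphic pairs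
of arrows. -/
class CoherentFunctor {C : Type u₁} [Category.{v₁} C] {D : Type u₂} [Category.{v₂} D]
    (F : C ⥤ D) : Prop extends PreservesFiniteLimits F where
  map_jointlyExtremallyEpic : ∀ {A B Z : C} (f : A ⟶ Z) (g : B ⟶ Z),
    JointlyExtremallyEpic f g → JointlyExtremallyEpic (F.map f) (F.map g)

/-- The image `F(S) ≤ F(X)` of a subobject `S ≤ X` under a functor preserving finite limits (hence
monomorphisms): it is represented by `F(S) ⟶ F(X)`. -/
noncomputable def mapSubobject {C : Type u₁} [Category.{v₁} C] {D : Type u₂} [Category.{v₂} D]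
    [HasFiniteLimits C] (F : C ⥤ D) [PreservesFiniteLimits F] {X : C} (S : Subobject X) :
    Subobject (F.obj X) :=
  Subobject.mk (F.map S.arrow)

section Commutator

variable {C : Type u₁} [Category.{v₁} C] [HasZeroObject C] [HasZeroMorphisms C]
  [HasBinaryCoproducts C] {n : ℕ}

/-- The coproduct of the objects `K i` with `i ≠ k`. -/
noncomputable abbrev coproductOmit (K : Fin n → C) (k : Fin n) : C :=
  ∐ fun i : {i : Fin n // i ≠ k} => K i.1

/-- The morphism from the coproduct of all `K i` to the coproduct of the `K i` with `i ≠ k` which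
is zero on `K k` and the canonical inclusion on the other summands. -/
noncomputable def projOmit (K : Fin n → C) (k : Fin n) : (∐ K) ⟶ coproductOmit K k :=
  Sigma.desc fun i =>
    if h : i = k then 0 else Sigma.ι (fun i : {i : Fin n // i ≠ k} => K i.1) ⟨i, h⟩

variable [Regular C]

/-- The morphism `r` from the coproduct of the `K i` to the product over `k` of the coproducts
omitting `K k`, with components `projOmit K k`. -/
noncomputable def coproductToProduct (K : Fin n → C) : (∐ K) ⟶ ∏ᶜ fun k => coproductOmit K k :=
  Pi.lift (projOmit K)

/-- The co-smash product of `K 0, …, K (n - 1)`: the kernel of `coproductToProduct K`. -/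
noncomputable def cosmash (K : Fin n → C) : C :=
  kernel (coproductToProduct K)

/-- The inclusion of the co-smash product into the coproduct. -/
noncomputable def cosmashι (K : Fin n → C) : cosmash K ⟶ ∐ K :=
  kernel.ι (coproductToProduct K)

/-- The Higgins commutator of a family of arrows `k i : K i ⟶ X`: the image of the composite of the
co-smash product inclusion with the arrow from the coproduct to `X` induced by the `k i`. -/
noncomputable def higginsCommutatorOfArrows {K : Fin n → C} {X : C} (k : ∀ i, K i ⟶ X) : Subobject X :=
  imageSubobject (cosmashι K ≫ Sigma.desc k)

/-- The Higgins commutator `[K 0, …, K (n - 1)] ≤ X` of subobjects of `X`, computed from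
monomorphisms representing them. -/
noncomputable def higginsCommutator {X : C} (K : Fin n → Subobject X) : Subobject X :=
  higginsCommutatorOfArrows fun i => (K i).arrow

end Commutator

end HigginsCommutator

/-! The co-smash product is the joint kernel of the commuting idempotents `killSummand K k` on `∐
K`, and `F` preserves such joint kernels. Coherence also makes `F` preserve strong epimorphisms,
hence images, and makes the comparison `∐ F(K i) ⟶ F(∐ K)` a strong epimorphism. It intertwines the
two families of idempotents.

What remains is that it restricts to a strong epimorphism between the joint kernels, so that both
have the same image in `F(X)`. For one idempotent this follows from difunctionality of relations in
a Mal'tsev category (`strongEpi_kernel_map`). Since the idempotents commute, the others restrict to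
its kernel, and induction gives `exists_lift_of_idempotents`. -/

namespace HigginsCommutator

open scoped ZeroObject

attribute [local simp] prod.lift_fst prod.lift_snd pullback.lift_fst pullback.lift_snd
  prod.lift_fst_assoc prod.lift_snd_assoc pullback.lift_fst_assoc pullback.lift_snd_assoc

/-! ### Strong epimorphisms and images in regular categories -/

section Regular

variable {C : Type u₁} [Category.{v₁} C] [Regular C]

lemma strongEpi_pullback_fst {X Y Z : C} (f : X ⟶ Z) (g : Y ⟶ Z) [StrongEpi g] :
    StrongEpi (pullback.fst f g) := by
  have : IsRegularEpi g := Regular.isRegularEpi_of_extremalEpi g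
  infer_instance

lemma strongEpi_pullback_snd {X Y Z : C} (f : X ⟶ Z) (g : Y ⟶ Z) [StrongEpi f] :
    StrongEpi (pullback.snd f g) := by
  have : IsRegularEpi f := Regular.isRegularEpi_of_extremalEpi f
  infer_instance

lemma strongEpi_of_forall_mono {X Y : C} (f : X ⟶ Y)
    (h : ∀ ⦃M : C⦄ (m : M ⟶ Y) [Mono m], (∃ a : X ⟶ M, a ≫ m = f) → IsIso m) :
    StrongEpi f :=
  (extremalEpi_iff_strongEpi_of_hasPullbacks f).1
    (ExtremalEpi.mk_of_hasEqualizers f fun _ p i fac _ => h i ⟨p, fac⟩)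

lemma imageSubobject_le_of_strongEpi {Q T Y : C} (p : Q ⟶ T) [StrongEpi p] (g : T ⟶ Y)
    {S : Subobject Y} (s : Q ⟶ S) (h : s ≫ S.arrow = p ≫ g) : imageSubobject g ≤ S := by
  have sq : CommSq s p S.arrow g := ⟨h⟩
  exact imageSubobject_le g sq.lift (by simp)

lemma imageSubobject_eq_mk {X I Y : C} (e : X ⟶ I) [StrongEpi e] (m : I ⟶ Y) [Mono m] :
    imageSubobject (e ≫ m) = Subobject.mk m := by
  rw [← imageSubobject_mono m]
  exact le_antisymm (imageSubobject_comp_le _ _)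
    (imageSubobject_le_of_strongEpi e m (factorThruImageSubobject _) (by simp))

end Regular

/-! ### Lifting joint kernels of idempotents in Mal'tsev categories -/

section Maltsev

variable {C : Type u₁} [Category.{v₁} C]

/-- Every relation in a Mal'tsev category is difunctional: if `x R y`, `x' R y'` and `x R y'` then
`x' R y`. -/
lemma difunctional [MaltsevCategory C] {R X Y : C} (r₁ : R ⟶ X) (r₂ : R ⟶ Y)
    [JointlyMono₂ r₁ r₂] {T : C} (u v w : T ⟶ R) (h₁ : w ≫ r₁ = u ≫ r₁)
    (h₂ : w ≫ r₂ = v ≫ r₂) : ∃ t : T ⟶ R, t ≫ r₁ = v ≫ r₁ ∧ t ≫ r₂ = u ≫ r₂ := by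
  -- `S` relates `a` to `b` in `R` when `(r₁ a, r₂ b)` lies in `R`. It is reflexive; its symmetry is
  -- the claim.
  let S := pullback (prod.lift r₁ r₂) (prod.map r₁ r₂)
  let s : S ⟶ R := pullback.fst _ _
  let p₁ : S ⟶ R := pullback.snd _ _ ≫ prod.fst
  let p₂ : S ⟶ R := pullback.snd _ _ ≫ prod.snd
  have hs₁ : s ≫ r₁ = p₁ ≫ r₁ := by
    simpa [s, p₁] using (pullback.condition (f := prod.lift r₁ r₂)
      (g := prod.map r₁ r₂)) =≫ prod.fst
  have hs₂ : s ≫ r₂ = p₂ ≫ r₂ := by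
    simpa [s, p₂] using (pullback.condition (f := prod.lift r₁ r₂)
      (g := prod.map r₁ r₂)) =≫ prod.snd
  have hS : ReflexiveRelation p₁ p₂ :=
    { right_cancellation := fun T f g h₁ h₂ => by
        apply pullback.hom_ext
        · apply JointlyMono₂.right_cancellation (p₁ := r₁) (p₂ := r₂)
          · change (f ≫ s) ≫ r₁ = (g ≫ s) ≫ r₁
            simp only [Category.assoc, hs₁, reassoc_of% h₁]
          · change (f ≫ s) ≫ r₂ = (g ≫ s) ≫ r₂
            simp only [Category.assoc, hs₂, reassoc_of% h₂]
        · apply Limits.prod.hom_ext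
          · simpa [p₁] using h₁
          · simpa [p₂] using h₂
      r := pullback.lift (𝟙 _) (diag R) (by simp)
      reflexivity₁ := by simp [p₁]
      reflexivity₂ := by simp [p₂] }
  obtain ⟨⟨E⟩⟩ := MaltsevCategory.isEquivalenceRelation_of_reflexive p₁ p₂ hS
  let z : T ⟶ S := pullback.lift w (prod.lift u v) (by ext <;> simp [h₁, h₂])
  have hz₁ : z ≫ p₁ = u := by simp [z, p₁]
  have hz₂ : z ≫ p₂ = v := by simp [z, p₂]
  refine ⟨z ≫ E.s ≫ s, ?_, ?_⟩
  · rw [Category.assoc, Category.assoc, hs₁, reassoc_of% E.symmetry₁, reassoc_of% hz₂]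
  · rw [Category.assoc, Category.assoc, hs₂, reassoc_of% E.symmetry₂, reassoc_of% hz₁]

variable [Regular C] [MaltsevCategory C] [HasZeroMorphisms C]

/-- Let `e' x = 0` and, locally, `x = σ a`. The image of `(σ, e)` contains `(0, 0)`, `(x, e a)` and,
via `e a`, also `(0, e a)`. By difunctionality it contains `(x, 0)`: locally `x = σ y` with `e y =
0`. -/
lemma strongEpi_kernel_map {A A' : C} (σ : A ⟶ A') [StrongEpi σ] (e : A ⟶ A) (e' : A' ⟶ A')
    (he : e ≫ e = e) (hσ : e ≫ σ = σ ≫ e') : StrongEpi (kernel.map e e' σ σ hσ) := by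
  let q := factorThruImage (prod.lift σ e)
  let r₁ := image.ι (prod.lift σ e) ≫ prod.fst
  let r₂ := image.ι (prod.lift σ e) ≫ prod.snd
  have hq₁ : q ≫ r₁ = σ := by simp [q, r₁]
  have hq₂ : q ≫ r₂ = e := by simp [q, r₂]
  have : JointlyMono₂ r₁ r₂ := ⟨fun T f g h₁ h₂ => by
    rw [← cancel_mono (image.ι (prod.lift σ e))]
    apply Limits.prod.hom_ext
    · simpa [r₁] using h₁
    · simpa [r₂] using h₂⟩
  let p : pullback σ (kernel.ι e') ⟶ kernel e' := pullback.snd _ _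
  let a : pullback σ (kernel.ι e') ⟶ A := pullback.fst _ _
  have ha : a ≫ σ = p ≫ kernel.ι e' := pullback.condition
  obtain ⟨t, ht₁, ht₂⟩ := difunctional r₁ r₂ 0 (a ≫ q) (a ≫ e ≫ q)
    (by simp [hq₁, hσ, reassoc_of% ha]) (by simp [hq₂, he])
  have : StrongEpi q := inferInstanceAs (StrongEpi (factorThruImage _))
  have : StrongEpi p := strongEpi_pullback_snd _ _
  have : StrongEpi (pullback.fst t q) := strongEpi_pullback_fst _ _
  have hy : pullback.snd t q ≫ e = 0 := by
    calc _ = (pullback.snd t q ≫ q) ≫ r₂ := by rw [Category.assoc, hq₂]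
      _ = 0 := by rw [← pullback.condition, Category.assoc, ht₂]; simp
  have hyσ : pullback.snd t q ≫ σ = pullback.fst t q ≫ p ≫ kernel.ι e' := by
    calc _ = (pullback.snd t q ≫ q) ≫ r₁ := by rw [Category.assoc, hq₁]
      _ = _ := by rw [← pullback.condition, Category.assoc, ht₁, Category.assoc, hq₁, ha]
  have hfac : kernel.lift e (pullback.snd t q) hy ≫ kernel.map e e' σ σ hσ =
      pullback.fst t q ≫ p := by
    rw [← cancel_mono (kernel.ι e')]
    simp [hyσ]
  have : StrongEpi (kernel.lift e (pullback.snd t q) hy ≫ kernel.map e e' σ σ hσ) := by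
    rw [hfac]
    exact strongEpi_comp _ _
  exact strongEpi_of_strongEpi (kernel.lift e (pullback.snd t q) hy) _

/-- Let `σ` be a strong epimorphism compatible with families `e` and `e'` of commuting idempotents.
Then `σ` restricts to a strong epimorphism between the joint kernels of `e` and `e'`, in terms of
generalized elements. -/
lemma exists_lift_of_idempotents (n : ℕ) : ∀ {A A' : C} (σ : A ⟶ A') [StrongEpi σ]
    (e : Fin n → (A ⟶ A)) (e' : Fin n → (A' ⟶ A')) (_ : ∀ i, e i ≫ e i = e i)
    (_ : ∀ i j, e i ≫ e j = e j ≫ e i) (_ : ∀ i, e i ≫ σ = σ ≫ e' i)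
    {T : C} (x : T ⟶ A') (_ : ∀ i, x ≫ e' i = 0),
    ∃ (Q : C) (p : Q ⟶ T) (y : Q ⟶ A), StrongEpi p ∧ y ≫ σ = p ≫ x ∧ ∀ i, y ≫ e i = 0 := by
  induction n with
  | zero =>
    intro A A' σ _ e e' _ _ _ T x _
    exact ⟨_, pullback.fst x σ, pullback.snd x σ, strongEpi_pullback_fst _ _,
      pullback.condition.symm, fun i => i.elim0⟩
  | succ n ih =>
    intro A A' σ _ e e' he hc hσ T x hx
    have hc' : ∀ i j, e' i ≫ e' j = e' j ≫ e' i := fun i j => by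
      rw [← cancel_epi σ, ← reassoc_of% (hσ i), ← hσ j, ← reassoc_of% (hσ j), ← hσ i,
        reassoc_of% (hc i j)]
    have := strongEpi_kernel_map σ (e 0) (e' 0) (he 0) (hσ 0)
    -- By commutation the remaining idempotents act on the kernels of `e 0` and `e' 0`.
    obtain ⟨Q, p, y, hp, hy, hye⟩ := ih (kernel.map (e 0) (e' 0) σ σ (hσ 0))
      (fun i => kernel.map (e 0) (e 0) (e i.succ) (e i.succ) (hc 0 i.succ))
      (fun i => kernel.map (e' 0) (e' 0) (e' i.succ) (e' i.succ) (hc' 0 i.succ))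
      (fun i => by rw [← cancel_mono (kernel.ι _)]; simp [he])
      (fun i j => by rw [← cancel_mono (kernel.ι _)]; simp [hc i.succ j.succ])
      (fun i => by rw [← cancel_mono (kernel.ι _)]; simp [hσ])
      (kernel.lift (e' 0) x (hx 0))
      (fun i => by rw [← cancel_mono (kernel.ι _)]; simp [hx])
    refine ⟨Q, p, y ≫ kernel.ι _, hp, ?_, fun i => ?_⟩
    · simpa using hy =≫ kernel.ι _
    · refine Fin.cases (by simp) (fun i => ?_) i
      simpa using hye i =≫ kernel.ι _

end Maltsev

/-! ### Coherent functors: images and coproduct comparison -/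

section Coherent

variable {C : Type u₁} [Category.{v₁} C] {D : Type u₂} [Category.{v₂} D]
  [Regular D] (F : C ⥤ D) [CoherentFunctor F]

/-- Apply coherence to the pair `(f, f)`. -/
lemma strongEpi_map {X Y : C} (f : X ⟶ Y) [StrongEpi f] : StrongEpi (F.map f) := by
  refine strongEpi_of_forall_mono _ fun M m _ h => ?_
  refine CoherentFunctor.map_jointlyExtremallyEpic f f ?_ m h h
  rintro N i _ ⟨a, ha⟩ -
  exact ExtremalEpi.isIso f a i ha

lemma mapSubobject_imageSubobject [Regular C] {X Y : C} (f : X ⟶ Y) :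
    mapSubobject F (imageSubobject f) = imageSubobject (F.map f) := by
  have : StrongEpi (factorThruImageSubobject f) := by
    have h : StrongEpi (factorThruImage f ≫ (imageSubobjectIso f).inv) := strongEpi_comp _ _
    exact h
  have := strongEpi_map F (factorThruImageSubobject f)
  conv_rhs => rw [← imageSubobject_arrow_comp f, F.map_comp]
  rw [imageSubobject_eq_mk]
  rfl

/-- A finite family version of the preservation of jointly extremally epimorphic pairs. -/
lemma isIso_of_jointlyExtremallyEpic_family [HasZeroObject C] [HasZeroMorphisms C]
    [HasBinaryCoproducts C] [HasZeroObject D] [HasZeroMorphisms D] [Regular C]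
    [F.PreservesZeroMorphisms] (n : ℕ) :
    ∀ {K : Fin n → C} {Z : C} (f : ∀ i, K i ⟶ Z)
      (_ : ∀ ⦃M : C⦄ (m : M ⟶ Z) [Mono m], (∀ i, ∃ a : K i ⟶ M, a ≫ m = f i) → IsIso m)
      ⦃M : D⦄ (m : M ⟶ F.obj Z) [Mono m] (_ : ∀ i, ∃ a : F.obj (K i) ⟶ M, a ≫ m = F.map (f i)),
      IsIso m := by
  induction n with
  | zero =>
    intro K Z f hf M m _ _
    have : IsIso (0 : (0 : C) ⟶ Z) := hf _ fun i => i.elim0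
    have hZ : IsZero (F.obj Z) :=
      F.map_isZero ((isZero_zero C).of_iso (asIso (0 : (0 : C) ⟶ Z)).symm)
    exact ⟨0, by rw [← cancel_mono m]; exact hZ.eq_of_tgt _ _, hZ.eq_of_src _ _⟩
  | succ n ih =>
    intro K Z f hf M m _ hM
    let g := Sigma.desc fun i : Fin n => f i.succ
    let ι := image.ι g
    have hι : ∀ i : Fin n, (Sigma.ι (fun i : Fin n => K i.succ) i ≫ factorThruImage g) ≫ ι =
        f i.succ := fun i => by simp [ι, g]
    -- The tail of the family is replaced by its joint image `ι`, leaving a pair.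
    have hpair : JointlyExtremallyEpic (f 0) ι := by
      rintro N j _ ⟨a, ha⟩ ⟨b, hb⟩
      exact hf j fun i => Fin.cases ⟨a, ha⟩ (fun i => ⟨_ ≫ b, by
        rw [Category.assoc, hb, hι]⟩) i
    -- By induction on the tail, corestricted to its image, `F.map ι` factors through `m`.
    have hsnd : IsIso (pullback.snd m (F.map ι)) := by
      refine ih (fun i => Sigma.ι (fun i : Fin n => K i.succ) i ≫ factorThruImage g) ?_ _ ?_
      · intro N j _ hN
        choose a ha using hN
        have hfac : Sigma.desc a ≫ j ≫ ι = g := by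
          refine Sigma.hom_ext _ _ fun i => ?_
          rw [Sigma.ι_desc_assoc, reassoc_of% (ha i), ← Category.assoc, hι]
          simp [g]
        have := ExtremalEpi.isIso (factorThruImage g) (Sigma.desc a) j (by
          rw [← cancel_mono ι, Category.assoc, hfac, image.fac])
        exact this
      · intro i
        obtain ⟨a, ha⟩ := hM i.succ
        exact ⟨pullback.lift a (F.map (Sigma.ι (fun i : Fin n => K i.succ) i ≫ factorThruImage g))
          (by rw [ha, ← F.map_comp, hι]), pullback.lift_snd _ _ _⟩
    exact CoherentFunctor.map_jointlyExtremallyEpic _ _ hpair m (hM 0)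
      ⟨inv (pullback.snd m (F.map ι)) ≫ pullback.fst _ _, by
        rw [Category.assoc, pullback.condition, IsIso.inv_hom_id_assoc]⟩

lemma strongEpi_sigmaComparison [HasZeroObject C] [HasZeroMorphisms C]
    [HasBinaryCoproducts C] [HasZeroObject D] [HasZeroMorphisms D] [HasBinaryCoproducts D]
    [Regular C] [F.PreservesZeroMorphisms] {n : ℕ} (K : Fin n → C) :
    StrongEpi (sigmaComparison F K) := by
  refine strongEpi_of_forall_mono _ fun M m _ ⟨a, ha⟩ =>
    isIso_of_jointlyExtremallyEpic_family F n (Sigma.ι K) ?_ m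
      fun i => ⟨Sigma.ι (fun i => F.obj (K i)) i ≫ a, by simp [ha]⟩
  -- A monomorphism through which all coproduct inclusions factor is split epi.
  intro N j _ hN
  choose b hb using hN
  have hsplit : Sigma.desc b ≫ j = 𝟙 _ := by
    refine Sigma.hom_ext _ _ fun i => ?_
    simp [hb]
  exact ⟨Sigma.desc b, by rw [← cancel_mono j]; simp [hsplit], hsplit⟩

end Coherent

/-! ### Co-smash products as joint kernels of idempotents -/

section Cosmash

variable {C : Type u₁} [Category.{v₁} C] [HasZeroObject C] [HasZeroMorphisms C]
  [HasBinaryCoproducts C] {n : ℕ}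

/-- The idempotent of the coproduct that is zero on the summand `K k` and the identity on the
others. -/
noncomputable def killSummand (K : Fin n → C) (k : Fin n) : (∐ K) ⟶ ∐ K :=
  Sigma.desc fun i => if i = k then 0 else Sigma.ι K i

lemma ι_killSummand_self (K : Fin n → C) (k : Fin n) : Sigma.ι K k ≫ killSummand K k = 0 := by
  simp [killSummand]

lemma ι_killSummand_of_ne (K : Fin n → C) {i k : Fin n} (h : i ≠ k) :
    Sigma.ι K i ≫ killSummand K k = Sigma.ι K i := by
  simp [killSummand, h]

lemma killSummand_idem (K : Fin n → C) (k : Fin n) :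
    killSummand K k ≫ killSummand K k = killSummand K k := by
  refine Sigma.hom_ext _ _ fun i => ?_
  by_cases h : i = k
  · subst h
    simp [reassoc_of% (ι_killSummand_self K i), ι_killSummand_self]
  · simp [reassoc_of% (ι_killSummand_of_ne K h), ι_killSummand_of_ne K h]

lemma killSummand_comm (K : Fin n → C) (k l : Fin n) :
    killSummand K k ≫ killSummand K l = killSummand K l ≫ killSummand K k := by
  refine Sigma.hom_ext _ _ fun i => ?_
  simp only [killSummand, colimit.ι_desc_assoc, Cofan.mk_ι_app]
  split_ifs <;> simp [*]

/-- With `killSummand_comp_projOmit`, this shows that `projOmit K k` and `killSummand K k`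
annihilate the same arrows. -/
lemma projOmit_comp_desc (K : Fin n → C) (k : Fin n) :
    projOmit K k ≫ Sigma.desc (fun i => Sigma.ι K i.1) = killSummand K k := by
  refine Sigma.hom_ext _ _ fun i => ?_
  by_cases h : i = k <;> simp [projOmit, killSummand, h]

lemma killSummand_comp_projOmit (K : Fin n → C) (k : Fin n) :
    killSummand K k ≫ projOmit K k = projOmit K k := by
  refine Sigma.hom_ext _ _ fun i => ?_
  by_cases h : i = k <;> simp [projOmit, killSummand, h]

variable [Regular C]

lemma cosmashι_comp_killSummand (K : Fin n → C) (k : Fin n) :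
    cosmashι K ≫ killSummand K k = 0 := by
  have h : cosmashι K ≫ projOmit K k = 0 := by
    have := kernel.condition (coproductToProduct K) =≫ Pi.π _ k
    rwa [zero_comp, Category.assoc, coproductToProduct, limit.lift_π] at this
  rw [← projOmit_comp_desc, reassoc_of% h, zero_comp]

lemma comp_coproductToProduct_eq_zero (K : Fin n → C) {T : C} (x : T ⟶ ∐ K)
    (hx : ∀ k, x ≫ killSummand K k = 0) : x ≫ coproductToProduct K = 0 := by
  refine Pi.hom_ext _ _ fun k => ?_
  rw [Category.assoc, coproductToProduct, limit.lift_π, Fan.mk_π_app,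
    ← killSummand_comp_projOmit K k, reassoc_of% (hx k), zero_comp, zero_comp]

lemma exists_comp_cosmashι (K : Fin n → C) {T : C} (x : T ⟶ ∐ K)
    (hx : ∀ k, x ≫ killSummand K k = 0) : ∃ t, t ≫ cosmashι K = x :=
  ⟨_, kernel.lift_ι _ x (comp_coproductToProduct_eq_zero K x hx)⟩

/-- Higgins commutators can be computed from any joint kernel `κ` of idempotents of a quotient of
the coproduct that lie below the idempotents `killSummand`. -/
lemma imageSubobject_eq_higginsCommutatorOfArrows [MaltsevCategory C] {K : Fin n → C} {X : C}
    (k : ∀ i, K i ⟶ X) {A M : C} (σ : (∐ K) ⟶ A) [StrongEpi σ] (e : Fin n → (A ⟶ A))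
    (hσ : ∀ i, killSummand K i ≫ σ = σ ≫ e i) (φ : A ⟶ X) (hφ : σ ≫ φ = Sigma.desc k)
    (κ : M ⟶ A) (hκ : ∀ i, κ ≫ e i = 0)
    (hκ' : ∀ ⦃T : C⦄ (x : T ⟶ A), (∀ i, x ≫ e i = 0) → ∃ t, t ≫ κ = x) :
    imageSubobject (κ ≫ φ) = higginsCommutatorOfArrows k := by
  apply le_antisymm
  -- After the cover `p`, `κ` lifts along `σ` into the co-smash product.
  · obtain ⟨Q, p, y, hp, hy, hye⟩ := exists_lift_of_idempotents n σ (killSummand K) e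
      (killSummand_idem K) (killSummand_comm K) hσ κ hκ
    obtain ⟨t, ht⟩ := exists_comp_cosmashι K y hye
    have h : (t ≫ factorThruImageSubobject (cosmashι K ≫ Sigma.desc k)) ≫
        (imageSubobject (cosmashι K ≫ Sigma.desc k)).arrow = p ≫ κ ≫ φ := by
      rw [Category.assoc, imageSubobject_arrow_comp, reassoc_of% ht, ← hφ, reassoc_of% hy]
    exact imageSubobject_le_of_strongEpi p _ _ h
  · obtain ⟨t, ht⟩ := hκ' (cosmashι K ≫ σ) fun i => by
      rw [Category.assoc, ← hσ, reassoc_of% (cosmashι_comp_killSummand K i), zero_comp]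
    refine imageSubobject_le _ (t ≫ factorThruImageSubobject (κ ≫ φ)) ?_
    rw [Category.assoc, imageSubobject_arrow_comp, reassoc_of% ht, hφ]

lemma higginsCommutatorOfArrows_iso_comp [MaltsevCategory C] {K L : Fin n → C} {X : C}
    (a : ∀ i, K i ≅ L i) (l : ∀ i, L i ⟶ X) :
    higginsCommutatorOfArrows (fun i => (a i).hom ≫ l i) = higginsCommutatorOfArrows l := by
  refine (imageSubobject_eq_higginsCommutatorOfArrows _ (Sigma.mapIso a).hom (killSummand L)
    (fun k => ?_) (Sigma.desc l) ?_ (cosmashι L) (cosmashι_comp_killSummand L) ?_).symm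
  · refine Sigma.hom_ext _ _ fun i => ?_
    by_cases h : i = k <;> simp [killSummand, h]
  · refine Sigma.hom_ext _ _ fun i => ?_
    simp
  · exact fun T x hx => exists_comp_cosmashι L x hx

end Cosmash

/-! ### Preservation of Higgins commutators -/

section Preservation

lemma preservesZeroMorphisms_of_preservesFiniteLimits {C : Type u₁} [Category.{v₁} C]
    [HasZeroObject C] [HasZeroMorphisms C] {D : Type u₂} [Category.{v₂} D] [HasZeroObject D]
    [HasZeroMorphisms D] (F : C ⥤ D) [PreservesFiniteLimits F] :
    F.PreservesZeroMorphisms :=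
  have : PreservesLimit (Functor.empty.{0} C) F := inferInstance
  Functor.preservesZeroMorphisms_of_map_zero_object
    ((F.mapIso HasZeroObject.zeroIsoTerminal).trans
      ((PreservesTerminal.iso F).trans HasZeroObject.zeroIsoTerminal.symm))

variable {C : Type u₁} [Category.{v₁} C] [HasZeroObject C] [HasZeroMorphisms C] [Regular C]
  [HasBinaryCoproducts C]
  {D : Type u₂} [Category.{v₂} D] [HasZeroObject D] [HasZeroMorphisms D] [Regular D]
  [MaltsevCategory D] [HasBinaryCoproducts D] (F : C ⥤ D) [CoherentFunctor F] {n : ℕ}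

lemma exists_comp_map_cosmashι [F.PreservesZeroMorphisms] (K : Fin n → C) {T : D}
    (x : T ⟶ F.obj (∐ K)) (hx : ∀ k, x ≫ F.map (killSummand K k) = 0) :
    ∃ t, t ≫ F.map (cosmashι K) = x := by
  have h : x ≫ F.map (coproductToProduct K) = 0 := by
    -- `F` preserves the product, so vanishing is tested on components.
    rw [← cancel_mono (piComparison F fun k => coproductOmit K k)]
    refine Pi.hom_ext _ _ fun k => ?_
    rw [Category.assoc, Category.assoc, piComparison_comp_π, ← F.map_comp, coproductToProduct,
      limit.lift_π, Fan.mk_π_app, ← killSummand_comp_projOmit K k, F.map_comp, reassoc_of% (hx k),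
      zero_comp, zero_comp, zero_comp]
  have hlift : (kernel.lift _ x h ≫ (PreservesKernel.iso F (coproductToProduct K)).inv) ≫
      F.map (kernel.ι (coproductToProduct K)) = x := by
    rw [Category.assoc, PreservesKernel.iso_inv_ι, kernel.lift_ι]
  exact ⟨_, hlift⟩

theorem mapSubobject_higginsCommutatorOfArrows {K : Fin n → C} {X : C} (k : ∀ i, K i ⟶ X) :
    mapSubobject F (higginsCommutatorOfArrows k) =
      higginsCommutatorOfArrows fun i => F.map (k i) := by
  have := preservesZeroMorphisms_of_preservesFiniteLimits F
  have := strongEpi_sigmaComparison F K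
  rw [higginsCommutatorOfArrows, mapSubobject_imageSubobject, F.map_comp]
  refine imageSubobject_eq_higginsCommutatorOfArrows _ (sigmaComparison F K)
    (fun i => F.map (killSummand K i)) (fun l => ?_) _ ?_ _ (fun i => ?_)
    fun T x hx => exists_comp_map_cosmashι F K x hx
  · refine Sigma.hom_ext _ _ fun i => ?_
    rw [ι_comp_sigmaComparison_assoc, ← F.map_comp]
    by_cases h : i = l <;> simp [killSummand, h]
  · refine Sigma.hom_ext _ _ fun i => ?_
    simp
  · rw [← F.map_comp, cosmashι_comp_killSummand, F.map_zero]

theorem mapSubobject_higginsCommutator {X : C} (K : Fin n → Subobject X) :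
    mapSubobject F (higginsCommutator K) = higginsCommutator fun i => mapSubobject F (K i) := by
  rw [higginsCommutator, mapSubobject_higginsCommutatorOfArrows, higginsCommutator]
  -- The chosen arrow of `mapSubobject F (K i)` agrees with `F.map (K i).arrow` only up to
  -- isomorphism of domains.
  refine Eq.trans ?_ (higginsCommutatorOfArrows_iso_comp
    (fun i => (Subobject.underlyingIso (F.map (K i).arrow)).symm)
    (fun i => (mapSubobject F (K i)).arrow))
  congr 1
  funext i
  exact (Subobject.underlyingIso_arrow _).symm

end Preservation

end HigginsCommutator

/-- A coherent functor between pointed regular Mal'tsev categories with binary coproducts preserves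
Higgins commutators of arbitrary length, both those of families of arrows with common codomain and,
in particular, those of families of subobjects. -/
theorem proposition3p2
    {C : Type u₁} [Category.{v₁} C] [HasZeroObject C] [HasZeroMorphisms C] [Regular C]
    [HigginsCommutator.MaltsevCategory C] [HasBinaryCoproducts C]
    {D : Type u₂} [Category.{v₂} D] [HasZeroObject D] [HasZeroMorphisms D] [Regular D]
    [HigginsCommutator.MaltsevCategory D] [HasBinaryCoproducts D]
    (F : C ⥤ D) [HigginsCommutator.CoherentFunctor F] (n : ℕ) (hn : 2 ≤ n) (X : C) :
    (∀ K : Fin n → Subobject X,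
      HigginsCommutator.mapSubobject F (HigginsCommutator.higginsCommutator K) =
        HigginsCommutator.higginsCommutator fun i => HigginsCommutator.mapSubobject F (K i)) ∧
    (∀ (K : Fin n → C) (k : ∀ i, K i ⟶ X),
      HigginsCommutator.mapSubobject F (HigginsCommutator.higginsCommutatorOfArrows k) =
        HigginsCommutator.higginsCommutatorOfArrows fun i => F.map (k i)) :=
  ⟨fun K => HigginsCommutator.mapSubobject_higginsCommutator F K,
    fun _ k => HigginsCommutator.mapSubobject_higginsCommutatorOfArrows F k⟩
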